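/- **Setting.** Let $L=(L_1,\dots,L_J)$ be an integer vector, $|L|=L_1+\dots+L_J$, and let $\mathbb S^L\subset\mathbb R^{|L|}$ be the polyhedron of points $\beta=(\beta_{jl})_{1\le j\le J,\,1\le l\le L_j}$ with $\beta_{jl}\ge 0$ and $\sum_{l}\beta_{jl}=1$ for every $j$. A *$K$-dimensional LLS model* is a pair $(\mu,Q)$ of a linear subspace $Q\subset\mathbb R^{|L|}$ with $\dim Q=K$ and a probability measure $\mu$ (the mixing distribution) with $\mu(Q\cap\mathbb S^L)=1$. For a response pattern $\ell=(\ell_1,\dots,\ell_J)$ with $\ell_j\in\{0,1,\dots,L_j\}$ (where $0$ means "do not care"), the observable moment is $M_\ell(\mu)=\int\prod_{j:\ell_j\ne0}\beta_{j\ell_j}\,\mu(d\beta)$. Given a basis $\lambda^1,\dots,\lambda^K$ of $Q$, let $G=(G_1,\dots,G_K)$ be the random vector for which $\sum_kG_k\lambda^k$ has law $\mu$, and let $X_1,\dots,X_J$ be conditionally independent given $G$ with $P(X_j=l\mid G)=\sum_kG_k\lambda^k_{jl}$. For $v\in\mathbb Z_{\ge0}^K$ with $|v|=\sum_k v_k$,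 and $M_\ell(\mu)\ne0$, the conditional moment is $g^v_\ell=E(G_1^{v_1}\cdots G_K^{v_K}\mid X_j=\ell_j\text{ for all }j\text{ with }\ell_j\neq0)$. Let $Z(\ell)=\{j:\ell_j=0\}$. Say that $\ell$ *has enough zeros for order $d$* if $K\le\sum_{j\in Z(\ell)\setminus T}(L_j-1)+1$ for every $T\subseteq Z(\ell)$ with fewer than $d$ elements. The model $(\mu,Q)$ is *identifiable* if for every $K$-dimensional LLS model $(\mu',Q')$ with $M_\ell(\mu')=M_\ell(\mu)$ for all $\ell$ one has $Q'=Q$ and, for every basis of $Q$, every $v$ and every $\ell$ with $M_\ell(\mu)\ne0$ which has enough zeros for order $|v|$, the conditional moments $g^v_\ell$ of $\mu'$ and of $\mu$ in that basis coincide. *Almost surely* refers to the following. Let $V=\{\beta:\sum_l\beta_{jl}=0\text{ for all }j\}$. Lebesgue measure on the covariance matrices of rank $m$ of distributions on $\mathbb S^L$ is understood (up to null sets) as the image of Lebesgue measure on $V^m$ under $(f_1,\dots,f_m)\mapsto\sum_kf_kf_k^{T}$. **Theorem.** Suppose $K\le\frac{|L|-J}{2}-\max_jL_j+\frac52$. Let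 $\nu$ be any Borel measure on the family of mixing distributions of $K$-dimensional LLS models (with the topology of weak convergence) whose image under the map $\mu\mapsto\mathrm{Cov}(\mu)$ is absolutely continuous with respect to Lebesgue measure on the covariance matrices of rank $K-1$. Then for $\nu$-almost every $\mu$, and every $Q$ such that $(\mu,Q)$ is a $K$-dimensional LLS model, the model $(\mu,Q)$ is identifiable: its supporting subspace $Q$ and its conditional moments $g^v_\ell$ (for all $\ell$ having enough zeros for order $|v|$) are uniquely determined by the observable moments $M_\ell(\mu)$. -/

import Mathlib

open MeasureTheory ProbabilityTheory

namespace LLS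

noncomputable section

/-- Index set of the coordinates `(j, l)`, with `l` ranging over the `L j` possible values of the
`j`-th categorical variable. -/
abbrev Coord {J : ℕ} (L : Fin J → ℕ) : Type := Σ j : Fin J, Fin (L j)

/-- The space `ℝ^|L|`, where `|L| = L_1 + ... + L_J`. -/
abbrev BetaSpace {J : ℕ} (L : Fin J → ℕ) : Type := Coord L → ℝ

/-- The polyhedron of independent distributions: the points `β` with `β_{jl} ≥ 0` and
`∑_l β_{jl} = 1` for every `j`. -/
def polyhedron {J : ℕ} (L : Fin J → ℕ) : Set (BetaSpace L) :=
  {β | (∀ j, ∑ l, β ⟨j, l⟩ = 1) ∧ ∀ j l, 0 ≤ β ⟨j, l⟩}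

/-- `Q` is a supporting subspace of dimension `K` of the mixing distribution `μ`, i.e. `(μ, Q)` is a
`K`-dimensional LLS model: `dim Q = K` and `μ` is supported by `Q` and by the polyhedron. -/
def IsModel {J : ℕ} (L : Fin J → ℕ) (K : ℕ) (μ : ProbabilityMeasure (BetaSpace L))
    (Q : Submodule ℝ (BetaSpace L)) : Prop :=
  Module.finrank ℝ Q = K ∧ ∀ᵐ β ∂(μ : Measure (BetaSpace L)), β ∈ polyhedron L ∧ β ∈ Q

/-- The family of mixing distributions of `K`-dimensional LLS models. It carries the `σ`-algebra
generated by the evaluations `μ ↦ μ(S)`, which is the Borel `σ`-algebra of weak convergence. -/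
abbrev MixingDistribution {J : ℕ} (L : Fin J → ℕ) (K : ℕ) : Type :=
  {μ : ProbabilityMeasure (BetaSpace L) // ∃ Q : Submodule ℝ (BetaSpace L), IsModel L K μ Q}

/-- Response patterns with "do not care" places; `none` plays the role of `ℓ_j = 0`. -/
abbrev Pattern {J : ℕ} (L : Fin J → ℕ) : Type := (j : Fin J) → Option (Fin (L j))

/-- The set of "do not care" places of a response pattern. -/
def Pattern.zeros {J : ℕ} {L : Fin J → ℕ} (ℓ : Pattern L) : Finset (Fin J) :=
  Finset.univ.filter fun j => ℓ j = none

/-- The observable moment `M_ℓ(B) = ∫ ∏_{j : ℓ_j ≠ 0} β_{j ℓ_j} μ(dβ)`. -/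
def moment {J : ℕ} {L : Fin J → ℕ} (μ : ProbabilityMeasure (BetaSpace L)) (ℓ : Pattern L) : ℝ :=
  ∫ β, ∏ j, (ℓ j).elim 1 (fun l => β ⟨j, l⟩) ∂(μ : Measure (BetaSpace L))

/-- The map `g ↦ Λ g = ∑_k g_k λ^k` from coordinates to points. -/
def point {J : ℕ} {L : Fin J → ℕ} {K : ℕ} (lam : Fin K → BetaSpace L) (g : Fin K → ℝ) :
    BetaSpace L :=
  ∑ k, g k • lam k

/-- `λ^1, ..., λ^K` is a basis of `Q`. -/
def IsBasisOf {J : ℕ} {L : Fin J → ℕ} {K : ℕ} (lam : Fin K → BetaSpace L)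
    (Q : Submodule ℝ (BetaSpace L)) : Prop :=
  LinearIndependent ℝ lam ∧ Submodule.span ℝ (Set.range lam) = Q

/-- The mixing measure `μ` written in the coordinates `g` (for `lam` a basis of a supporting
subspace): `μ_g(S) = μ(Λ(S))`. -/
def coordMeasure {J : ℕ} {L : Fin J → ℕ} {K : ℕ} (μ : ProbabilityMeasure (BetaSpace L))
    (lam : Fin K → BetaSpace L) : Measure (Fin K → ℝ) :=
  (μ : Measure (BetaSpace L)).comap (point lam)

/-- The joint law of the responses `X = (X_1, ..., X_J)` and the latent vector `G`: `G` has law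
`μ_g`, and given `G = g` the `X_j` are independent with `P(X_j = l) = (Λ g)_{jl}`. That is,
`P(X = x, G ∈ S) = ∫_S ∏_j (Λ g)_{j x_j} μ_g(dg)`. -/
def jointLaw {J : ℕ} {L : Fin J → ℕ} {K : ℕ} (μ : ProbabilityMeasure (BetaSpace L))
    (lam : Fin K → BetaSpace L) : Measure (((j : Fin J) → Fin (L j)) × (Fin K → ℝ)) :=
  ∑ x : (j : Fin J) → Fin (L j), (Measure.dirac x).prod
    ((coordMeasure μ lam).withDensity fun g => ENNReal.ofReal (∏ j, point lam g ⟨j, x j⟩))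

/-- The event `X = ℓ`: `X_j = ℓ_j` for all `j` with `ℓ_j ≠ 0`. -/
def matchEvent {J : ℕ} {L : Fin J → ℕ} (K : ℕ) (ℓ : Pattern L) :
    Set (((j : Fin J) → Fin (L j)) × (Fin K → ℝ)) :=
  {z | ∀ j l, ℓ j = some l → z.1 j = l}

/-- The conditional moment `g^v_ℓ = E(G_1^{v_1} ⋯ G_K^{v_K} | X = ℓ)` in the basis `lam`. -/
def condMoment {J : ℕ} {L : Fin J → ℕ} {K : ℕ} (μ : ProbabilityMeasure (BetaSpace L))
    (lam : Fin K → BetaSpace L) (ℓ : Pattern L) (v : Fin K → ℕ) : ℝ :=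
  ∫ z, ∏ k, z.2 k ^ v k ∂(ProbabilityTheory.cond (jointLaw μ lam) (matchEvent K ℓ))

/-- The pattern `ℓ` has sufficiently many zeros for the conditional moments of order `d`: whenever
fewer than `d` of the zero places of `ℓ` are discarded, the remaining zero places `j` satisfy
`K ≤ ∑_j (L_j - 1) + 1`. For `d = 1` this reads `K ≤ l(ℓ) - p + 1`, with `p` the number of zeros of
`ℓ` and `l(ℓ)` the sum of the `L_j` over the zeros of `ℓ`. -/
def EnoughZeros {J : ℕ} {L : Fin J → ℕ} (K : ℕ) (ℓ : Pattern L) (d : ℕ) : Prop :=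
  ∀ T ⊆ ℓ.zeros, T.card < d → K ≤ ∑ j ∈ ℓ.zeros \ T, (L j - 1) + 1

/-- Identifiability of the `K`-dimensional LLS model `(μ, Q)`: every `K`-dimensional LLS model with
the same observable moments has the same supporting subspace and, in every basis of it, the same
conditional moments `g^v_ℓ` (for the patterns `ℓ` with sufficiently many zeros, and such that the
event `X = ℓ` on which one conditions has positive probability `M_ℓ(B)`). -/
def Identifiable {J : ℕ} (L : Fin J → ℕ) (K : ℕ) (μ : ProbabilityMeasure (BetaSpace L))
    (Q : Submodule ℝ (BetaSpace L)) : Prop :=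
  ∀ (μ' : ProbabilityMeasure (BetaSpace L)) (Q' : Submodule ℝ (BetaSpace L)),
    IsModel L K μ' Q' → (∀ ℓ : Pattern L, moment μ' ℓ = moment μ ℓ) →
      Q' = Q ∧
      ∀ lam : Fin K → BetaSpace L, IsBasisOf lam Q →
        ∀ (ℓ : Pattern L) (v : Fin K → ℕ), EnoughZeros K ℓ (∑ k, v k) → moment μ ℓ ≠ 0 →
          condMoment μ' lam ℓ v = condMoment μ lam ℓ v

/-- The covariance matrix of a mixing distribution. -/
def covMatrix {J : ℕ} {L : Fin J → ℕ} (μ : ProbabilityMeasure (BetaSpace L)) :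
    Coord L → Coord L → ℝ :=
  fun a b => covariance (fun β : BetaSpace L => β a) (fun β : BetaSpace L => β b)
    (μ : Measure (BetaSpace L))

/-- The direction space of the polyhedron: vectors with `∑_l β_{jl} = 0` for every `j`. -/
def directions {J : ℕ} (L : Fin J → ℕ) : Submodule ℝ (BetaSpace L) where
  carrier := {β | ∀ j, ∑ l, β ⟨j, l⟩ = 0}
  add_mem' := by
    intro a b ha hb j
    simp [Finset.sum_add_distrib, ha j, hb j]
  zero_mem' := by
    intro j
    simp
  smul_mem' := by
    intro c a ha j
    simp [← Finset.mul_sum, ha j]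

/-- Lebesgue measure on the covariance matrices of rank `m` of distributions on the polyhedron.
These matrices are the `∑_{k ≤ m} f_k f_kᵀ` with linearly independent `f_1, ..., f_m` in the
direction space; the measure is the image of Lebesgue (Haar) measure on the `m`-tuples
`(f_1, ..., f_m)`. It has the null sets of the Riemannian volume of the manifold of these
matrices; only its null sets matter. -/
def covLebesgue {J : ℕ} (L : Fin J → ℕ) (m : ℕ) : Measure (Coord L → Coord L → ℝ) :=
  (Measure.addHaar : Measure (Fin m → directions L)).map
    fun f a b => ∑ k, (f k : BetaSpace L) a * (f k : BetaSpace L) b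

end

end LLS

/-! The argument rests on low rank plus genericity. Write `m = K - 1`. Every column of the
covariance matrix lies in `Q ⊓ directions L`, of dimension at most `m`. Almost surely all its `m ×
m` minors along free coordinates are nonzero (`ae_generic_covMatrix`), so any `m` free columns span
that space and any `m` free coordinates are injective on it.

The moments give the mean and the covariances between different variables, but not those within one
variable. The bound on `K` is what is needed to fill these in: after removal of any one variable,
the others split into two groups with at least `m` free coordinates each (`exists_split_of_bound`).
Rows from one group fix the expansion of a column in columns from the other, through observed
entries only, and the expansion yields the missing entry (`covMatrix_eq_of_split`). The covariance
columns and the mean then span `Q`.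

With `Q` known, the moments `E(G^v; X = ℓ)` follow by induction on the order (`mixedMoment_unique`):
contracting those of order `d + 1` with the basis gives moments of order `d` with one more response
prescribed, and genericity makes this linear system injective. Dividing by the moment of `ℓ` gives
the conditional moments. -/

namespace LLS

/-! ### Free coordinates on the direction space. -/

/-- All coordinates but the last one of each variable; they are independent on `directions L`. -/
abbrev FreeCoord {J : ℕ} (L : Fin J → ℕ) : Type := Σ j : Fin J, Fin (L j - 1)

/-- The inclusion of the free coordinates. -/
def FreeCoord.toCoord {J : ℕ} {L : Fin J → ℕ} (a : FreeCoord L) : Coord L :=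
  ⟨a.1, ⟨a.2, by have := a.2.isLt; omega⟩⟩

/-- The last coordinate of the variable of a free coordinate. -/
def FreeCoord.last {J : ℕ} {L : Fin J → ℕ} (a : FreeCoord L) : Coord L :=
  ⟨a.1, ⟨L a.1 - 1, by have := a.2.isLt; omega⟩⟩

lemma FreeCoord.toCoord_injective {J : ℕ} {L : Fin J → ℕ} :
    Function.Injective (FreeCoord.toCoord (L := L)) := by
  rintro ⟨j, l⟩ ⟨j', l'⟩ h
  simp only [FreeCoord.toCoord, Sigma.mk.injEq] at h
  obtain ⟨rfl, h⟩ := h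
  simp only [heq_eq_eq, Fin.mk.injEq] at h
  rw [Fin.ext h]

lemma FreeCoord.toCoord_ne_last {J : ℕ} {L : Fin J → ℕ} (a b : FreeCoord L) :
    a.toCoord ≠ b.last := by
  obtain ⟨j, l⟩ := a
  obtain ⟨j', l'⟩ := b
  intro h
  simp only [FreeCoord.toCoord, FreeCoord.last, Sigma.mk.injEq] at h
  obtain ⟨rfl, h⟩ := h
  simp only [heq_eq_eq, Fin.mk.injEq] at h
  omega

/-- The direction which is `1` at the free coordinate `a` and `-1` at the last coordinate of the
same variable. -/
noncomputable def freeDirection {J : ℕ} {L : Fin J → ℕ} (a : FreeCoord L) : directions L :=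
  ⟨Pi.single a.toCoord 1 - Pi.single a.last 1, by
    intro j
    have key : ∀ c : Fin (L a.1), ∑ l, (Pi.single (⟨a.1, c⟩ : Coord L) (1 : ℝ) : BetaSpace L) ⟨j, l⟩
        = if j = a.1 then 1 else 0 := by
      intro c
      split_ifs with h
      · subst h
        rw [Finset.sum_eq_single c]
        · simp
        · intro b _ hb
          rw [Pi.single_eq_of_ne]
          simpa using hb
        · simp
      · apply Finset.sum_eq_zero
        intro l _
        rw [Pi.single_eq_of_ne]
        intro hh
        exact h (congrArg Sigma.fst hh)
    simp only [Pi.sub_apply, Finset.sum_sub_distrib]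
    have h1 := key ⟨a.2, by have := a.2.isLt; omega⟩
    have h2 := key ⟨L a.1 - 1, by have := a.2.isLt; omega⟩
    simp only [FreeCoord.toCoord, FreeCoord.last]
    rw [h1, h2, sub_self]⟩

lemma freeDirection_apply {J : ℕ} {L : Fin J → ℕ} (a b : FreeCoord L) :
    (freeDirection a : BetaSpace L) b.toCoord = if b = a then 1 else 0 := by
  simp only [freeDirection, Pi.sub_apply]
  rw [Pi.single_eq_of_ne (b.toCoord_ne_last a), sub_zero, Pi.single_apply]
  simp only [FreeCoord.toCoord_injective.eq_iff]

/-! ### Almost sure genericity of the covariance matrix. -/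

/-- All `m × m` minors of `C` along free coordinates are nonzero. -/
def Generic {J : ℕ} (L : Fin J → ℕ) (m : ℕ) (C : Coord L → Coord L → ℝ) : Prop :=
  ∀ A B : Fin m ↪ FreeCoord L,
    (Matrix.of fun i k => C (A i).toCoord (B k).toCoord).det ≠ 0

lemma measurableSet_generic {J : ℕ} (L : Fin J → ℕ) (m : ℕ) :
    MeasurableSet {C | Generic L m C} := by
  have : {C | Generic L m C} = ⋂ A : Fin m ↪ FreeCoord L, ⋂ B : Fin m ↪ FreeCoord L,
      {C | (Matrix.of fun i k => C (A i).toCoord (B k).toCoord).det ≠ 0} := by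
    ext C
    simp [Generic]
  rw [this]
  refine MeasurableSet.iInter fun A => MeasurableSet.iInter fun B => ?_
  apply IsOpen.measurableSet
  apply isOpen_ne_fun _ continuous_const
  apply Continuous.matrix_det
  exact continuous_matrix fun i k => by simp only [Matrix.of_apply]; fun_prop

/-- As a function of `t` this is the characteristic polynomial of `-M`, which is monic and so has
finitely many roots. -/
lemma ae_det_add_smul_one_ne_zero {n : Type*} [Fintype n] [DecidableEq n] (M : Matrix n n ℝ) :
    ∀ᵐ t : ℝ, (M + t • (1 : Matrix n n ℝ)).det ≠ 0 := by
  have hfin : {t : ℝ | (-M).charpoly.IsRoot t}.Finite :=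
    Polynomial.finite_setOfPred_isRoot (Matrix.charpoly_monic _).ne_zero
  have := hfin.countable.ae_notMem (volume : Measure ℝ)
  filter_upwards [this] with t ht h0
  apply ht
  show Polynomial.eval t _ = 0
  rw [Matrix.eval_charpoly, ← h0]
  congr 1
  ext i j
  simp [Matrix.one_apply, Matrix.diagonal_apply, add_comm]

lemma continuous_direction_apply {J : ℕ} {L : Fin J → ℕ} {m : ℕ} (k : Fin m) (a : Coord L) :
    Continuous fun f : Fin m → directions L => (f k : BetaSpace L) a :=
  (continuous_apply a).comp (continuous_subtype_val.comp (continuous_apply k))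

lemma ae_det_ne_zero {J : ℕ} (L : Fin J → ℕ) (m : ℕ) (A : Fin m ↪ FreeCoord L) :
    ∀ᵐ f ∂(Measure.addHaar : Measure (Fin m → directions L)),
      (Matrix.of fun i k => (f k : BetaSpace L) (A i).toCoord).det ≠ 0 := by
  -- In the coordinates `A` the tuple `g` is the identity matrix, so moving along `g` adds `t • 1`.
  -- Being nonzero for almost every `t` on each such line suffices, by Fubini.
  let g : Fin m → directions L := fun k => freeDirection (A k)
  refine ae_mem_of_ae_add_linearMap_mem (LinearMap.toSpanSingleton ℝ (Fin m → directions L) g)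
    (volume : Measure ℝ) _
    (s := {f | (Matrix.of fun i k => (f k : BetaSpace L) (A i).toCoord).det ≠ 0}) ?_ ?_
  · apply IsOpen.measurableSet
    apply isOpen_ne_fun _ continuous_const
    apply Continuous.matrix_det
    exact continuous_matrix fun i k => continuous_direction_apply k _
  · intro f
    filter_upwards [ae_det_add_smul_one_ne_zero
      (Matrix.of fun i k => (f k : BetaSpace L) (A i).toCoord)] with t ht
    show Matrix.det _ ≠ 0
    convert ht using 2
    ext i k
    simp [g, freeDirection_apply, Matrix.one_apply, A.injective.eq_iff]

/-- With `C = F Fᵀ` and `F` having exactly `m` columns, each `m × m` minor of `C` is the product of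
two maximal minors of `F`. -/
lemma ae_generic_covLebesgue {J : ℕ} (L : Fin J → ℕ) (m : ℕ) :
    ∀ᵐ C ∂(covLebesgue L m), Generic L m C := by
  unfold covLebesgue
  rw [ae_map_iff _ (measurableSet_generic L m)]
  · have := ae_all_iff.2 fun A => ae_det_ne_zero L m A
    filter_upwards [this] with f hf A B
    have hAB : (Matrix.of fun i k => (fun a b => ∑ k, (f k : BetaSpace L) a * (f k : BetaSpace L) b)
        (A i).toCoord (B k).toCoord) =
        (Matrix.of fun i k => (f k : BetaSpace L) (A i).toCoord) *
        (Matrix.of fun i k => (f k : BetaSpace L) (B i).toCoord).transpose := by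
      ext i k
      simp [Matrix.mul_apply]
    rw [hAB, Matrix.det_mul, Matrix.det_transpose]
    exact mul_ne_zero (hf A) (hf B)
  · refine Continuous.aemeasurable (continuous_pi fun a => continuous_pi fun b =>
      continuous_finsetSum _ fun k _ => ?_)
    exact (continuous_direction_apply k a).mul (continuous_direction_apply k b)

/-- The inclusion of mixing distributions into measures is a Markov kernel, so means and covariances
are integrals depending measurably on the parameter. -/
lemma measurable_covMatrix {J : ℕ} (L : Fin J → ℕ) (K : ℕ) :
    Measurable fun μ : MixingDistribution L K => covMatrix μ.1 := by
  let κ : Kernel (MixingDistribution L K) (BetaSpace L) :=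
    ⟨fun μ => (μ.1 : Measure (BetaSpace L)), measurable_subtype_coe.comp measurable_subtype_coe⟩
  have : IsMarkovKernel κ := ⟨fun μ => inferInstanceAs
    (IsProbabilityMeasure (μ.1 : Measure (BetaSpace L)))⟩
  refine measurable_pi_lambda _ fun a => measurable_pi_lambda _ fun b => ?_
  have hm : ∀ c : Coord L, Measurable fun μ : MixingDistribution L K => ∫ β, β c ∂(κ μ) :=
    fun c => (StronglyMeasurable.integral_kernel (κ := κ)
      (measurable_pi_apply c).stronglyMeasurable).measurable
  have h2 : StronglyMeasurable (Function.uncurry fun (μ : MixingDistribution L K)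
      (β : BetaSpace L) => (β a - ∫ β, β a ∂(κ μ)) * (β b - ∫ β, β b ∂(κ μ))) := by
    apply Measurable.stronglyMeasurable
    exact (((measurable_pi_apply a).comp measurable_snd).sub ((hm a).comp measurable_fst)).mul
      (((measurable_pi_apply b).comp measurable_snd).sub ((hm b).comp measurable_fst))
  exact (StronglyMeasurable.integral_kernel_prod_right (κ := κ) h2).measurable

lemma ae_generic_covMatrix {J : ℕ} {L : Fin J → ℕ} {K m : ℕ}
    {ν : Measure (MixingDistribution L K)}
    (hν : (ν.map fun μ => covMatrix μ.1).AbsolutelyContinuous (covLebesgue L m)) :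
    ∀ᵐ μ ∂ν, Generic L m (covMatrix μ.1) :=
  ae_of_ae_map (measurable_covMatrix L K).aemeasurable (hν.ae_le (ae_generic_covLebesgue L m))

/-! ### Splitting the variables into two large groups. -/

lemma exists_embedding_freeCoord {J : ℕ} (L : Fin J → ℕ) (m : ℕ) (S : Finset (Fin J))
    (h : m ≤ ∑ j ∈ S, (L j - 1)) : ∃ A : Fin m ↪ FreeCoord L, ∀ i, (A i).1 ∈ S := by
  have hc : (S.sigma fun j => (Finset.univ : Finset (Fin (L j - 1)))).card
      = ∑ j ∈ S, (L j - 1) := by simp [Finset.card_sigma]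
  have : Nonempty (Fin m ↪ {a // a ∈ S.sigma fun j => (Finset.univ : Finset (Fin (L j - 1)))}) :=
    Function.Embedding.nonempty_of_card_le (by rw [Fintype.card_fin, Fintype.card_coe, hc]; exact h)
  obtain ⟨A⟩ := this
  exact ⟨A.trans (Function.Embedding.subtype _), fun i => (Finset.mem_sigma.1 (A i).2).1⟩

/-- A minimal `S` of weight at least `m` drops below `m` when one element is removed, so its weight
is at most `m - 1 + c`; the complement keeps the rest. -/
lemma exists_split_sum_ge {ι : Type*} [DecidableEq ι] (U : Finset ι) (d : ι → ℕ) (m c : ℕ)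
    (hc : ∀ i ∈ U, d i ≤ c) (h : 2 * m + c ≤ ∑ i ∈ U, d i + 1) :
    ∃ S ⊆ U, m ≤ ∑ i ∈ S, d i ∧ m ≤ ∑ i ∈ U \ S, d i := by
  rcases Nat.eq_zero_or_pos m with rfl | hm
  · exact ⟨∅, by simp⟩
  obtain ⟨S, hS⟩ := exists_minimal_of_wellFoundedLT
    (fun S : Finset ι => S ⊆ U ∧ m ≤ ∑ i ∈ S, d i) ⟨U, subset_rfl, by omega⟩
  obtain ⟨hSU, hmS⟩ := hS.prop
  refine ⟨S, hSU, hmS, ?_⟩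
  have hne : S.Nonempty := by
    rw [Finset.nonempty_iff_ne_empty]
    rintro rfl
    simp at hmS
    omega
  obtain ⟨i, hi⟩ := hne
  have hlt : ∑ k ∈ S.erase i, d k < m := by
    by_contra! hcon
    have := hS.le_of_le ⟨(Finset.erase_subset i S).trans hSU, hcon⟩ (Finset.erase_subset i S)
    exact Finset.notMem_erase i S (this hi)
  have h1 := Finset.add_sum_erase S d hi
  have h2 := Finset.sum_sdiff (f := d) hSU
  have h3 := hc i (hSU hi)
  omega

/-! ### Subspaces controlled by one nonvanishing minor. -/

section LinearAlgebra

variable {ι : Type*} {m : ℕ} {W : Submodule ℝ (ι → ℝ)} {c : Fin m → ι → ℝ}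
  {a : Fin m → ι}

lemma coeff_eq_zero_of_det_ne_zero (hdet : (Matrix.of fun i k => c k (a i)).det ≠ 0)
    {y : Fin m → ℝ} (hy : ∀ i, ∑ k, y k * c k (a i) = 0) : y = 0 := by
  refine Matrix.eq_zero_of_mulVec_eq_zero hdet ?_
  ext i
  simp only [Matrix.mulVec, dotProduct, Matrix.of_apply, Pi.zero_apply]
  rw [← hy i]
  exact Finset.sum_congr rfl fun k _ => mul_comm _ _

lemma linearIndependent_of_det_ne_zero (hdet : (Matrix.of fun i k => c k (a i)).det ≠ 0) :
    LinearIndependent ℝ c := by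
  rw [Fintype.linearIndependent_iff]
  intro y hy
  refine fun i => congrFun (coeff_eq_zero_of_det_ne_zero hdet fun i => ?_) i
  have := congrFun hy (a i)
  simpa using this

/-- The minor makes the `m` vectors independent, and the dimension bound leaves no room for more. -/
lemma span_eq_of_det_ne_zero [Fintype ι] (hW : Module.finrank ℝ W ≤ m) (hc : ∀ k, c k ∈ W)
    (hdet : (Matrix.of fun i k => c k (a i)).det ≠ 0) :
    Submodule.span ℝ (Set.range c) = W := by
  apply Submodule.eq_of_le_of_finrank_le
  · rw [Submodule.span_le]
    rintro _ ⟨k, rfl⟩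
    exact hc k
  · rwa [finrank_span_eq_card (linearIndependent_of_det_ne_zero hdet), Fintype.card_fin]

lemma exists_coeff_of_det_ne_zero [Fintype ι] (hW : Module.finrank ℝ W ≤ m) (hc : ∀ k, c k ∈ W)
    (hdet : (Matrix.of fun i k => c k (a i)).det ≠ 0) {x : ι → ℝ} (hx : x ∈ W) :
    ∃ y : Fin m → ℝ, ∀ b, x b = ∑ k, y k * c k b := by
  rw [← span_eq_of_det_ne_zero hW hc hdet, Submodule.mem_span_range_iff_exists_fun] at hx
  obtain ⟨y, rfl⟩ := hx
  exact ⟨y, fun b => by simp⟩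

lemma eq_zero_of_det_ne_zero [Fintype ι] (hW : Module.finrank ℝ W ≤ m) (hc : ∀ k, c k ∈ W)
    (hdet : (Matrix.of fun i k => c k (a i)).det ≠ 0) {x : ι → ℝ} (hx : x ∈ W)
    (hxa : ∀ i, x (a i) = 0) : x = 0 := by
  obtain ⟨y, hy⟩ := exists_coeff_of_det_ne_zero hW hc hdet hx
  have : y = 0 := coeff_eq_zero_of_det_ne_zero hdet fun i => by rw [← hy, hxa]
  ext b
  simp [hy, this]

end LinearAlgebra

/-! ### Recovering the covariance matrix and the supporting subspace. -/

section Model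

variable {J : ℕ} {L : Fin J → ℕ} {K : ℕ} {μ μ' : ProbabilityMeasure (BetaSpace L)}
  {Q Q' : Submodule ℝ (BetaSpace L)}

lemma isCompact_polyhedron (L : Fin J → ℕ) : IsCompact (polyhedron L) := by
  apply (isCompact_Icc (a := (0 : BetaSpace L)) (b := 1)).of_isClosed_subset
  · have : polyhedron L = (⋂ j, {β | ∑ l, β ⟨j, l⟩ = 1}) ∩ ⋂ j, ⋂ l, {β | 0 ≤ β ⟨j, l⟩} := by
      ext β
      simp [polyhedron]
    rw [this]
    refine (isClosed_iInter fun j => isClosed_eq (by fun_prop) (by fun_prop)).inter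
      (isClosed_iInter fun j => isClosed_iInter fun l => isClosed_le (by fun_prop) (by fun_prop))
  · rintro β ⟨h1, h2⟩
    refine ⟨fun a => h2 a.1 a.2, fun a => ?_⟩
    rw [Pi.one_apply, ← h1 a.1]
    exact Finset.single_le_sum (f := fun l => β ⟨a.1, l⟩) (fun l _ => h2 a.1 l)
      (Finset.mem_univ a.2)

lemma integrable_of_ae_mem_compact {X E : Type*} [TopologicalSpace X] [T2Space X]
    [MeasurableSpace X] [OpensMeasurableSpace X] [NormedAddCommGroup E]
    [SecondCountableTopologyEither X E] {ρ : Measure X} [IsFiniteMeasure ρ] {S : Set X}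
    (hS : IsCompact S) (h : ∀ᵐ x ∂ρ, x ∈ S) {f : X → E} (hf : Continuous f) :
    Integrable f ρ := by
  have := hf.continuousOn.integrableOn_of_subset_isCompact (μ := ρ) hS hS.isClosed.measurableSet
    subset_rfl (measure_ne_top _ _)
  rwa [IntegrableOn, Measure.restrict_eq_self_of_ae_mem h] at this

lemma IsModel.integrable {E : Type*} [NormedAddCommGroup E] (h : IsModel L K μ Q)
    {f : BetaSpace L → E} (hf : Continuous f) : Integrable f (μ : Measure (BetaSpace L)) := by
  have : SecondCountableTopologyEither (BetaSpace L) E := inferInstance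
  exact integrable_of_ae_mem_compact (isCompact_polyhedron L) (h.2.mono fun _ hβ => hβ.1) hf

/-- The mean of a mixing distribution. -/
noncomputable def mean (μ : ProbabilityMeasure (BetaSpace L)) : BetaSpace L :=
  fun a => ∫ β, β a ∂(μ : Measure (BetaSpace L))

lemma IsModel.integral_mem (h : IsModel L K μ Q) {f : BetaSpace L → BetaSpace L}
    (hf : Continuous f) {P : Submodule ℝ (BetaSpace L)}
    (hP : ∀ᵐ β ∂(μ : Measure (BetaSpace L)), f β ∈ P) :
    (fun a => ∫ β, f β a ∂(μ : Measure (BetaSpace L))) ∈ P := by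
  have := P.convex.integral_mem P.closed_of_finiteDimensional hP (h.integrable hf)
  have heq : (fun a => ∫ β, f β a ∂(μ : Measure (BetaSpace L)))
      = ∫ β, f β ∂(μ : Measure (BetaSpace L)) := by
    ext a
    rw [eval_integral]
    exact fun i => h.integrable (by fun_prop)
  rw [heq]
  exact this

lemma IsModel.mean_mem (h : IsModel L K μ Q) : mean μ ∈ Q :=
  h.integral_mem continuous_id (h.2.mono fun _ hβ => hβ.2)

lemma IsModel.sum_mean (h : IsModel L K μ Q) (j : Fin J) : ∑ l, mean μ ⟨j, l⟩ = 1 := by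
  unfold mean
  rw [← integral_finsetSum _ fun l _ => h.integrable (by fun_prop)]
  rw [integral_congr_ae (g := fun _ => (1 : ℝ)) (h.2.mono fun β hβ => hβ.1.1 j)]
  simp

/-- A column is the mean of `(β b - mean μ b) • (β - mean μ)`, which almost surely lies in this
closed subspace. -/
lemma IsModel.covMatrix_mem (h : IsModel L K μ Q) (b : Coord L) :
    (fun a => covMatrix μ a b) ∈ Q ⊓ directions L := by
  have key := h.integral_mem (f := fun β => (β b - mean μ b) • (β - mean μ)) (by fun_prop)
    (P := Q ⊓ directions L) (h.2.mono fun β hβ => by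
      refine Submodule.smul_mem _ _ ⟨Q.sub_mem hβ.2 h.mean_mem, fun j => ?_⟩
      simp [hβ.1.1 j, h.sum_mean j])
  convert key using 2 with a
  unfold covMatrix covariance
  refine integral_congr_ae (Filter.Eventually.of_forall fun β => ?_)
  simp [mean, mul_comm]

lemma IsModel.covMatrix_eq (h : IsModel L K μ Q) (a b : Coord L) :
    covMatrix μ a b = ∫ β, β a * β b ∂(μ : Measure (BetaSpace L)) - mean μ a * mean μ b := by
  have h2 : ∀ c : Coord L, MemLp (fun β : BetaSpace L => β c) 2 (μ : Measure (BetaSpace L)) := by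
    intro c
    rw [memLp_two_iff_integrable_sq (continuous_apply c).aestronglyMeasurable]
    exact h.integrable (by fun_prop)
  exact covariance_eq_sub (h2 a) (h2 b)

lemma mean_eq_moment (μ : ProbabilityMeasure (BetaSpace L)) (a : Coord L) :
    mean μ a = moment μ (Function.update (fun _ => none) a.1 (some a.2)) := by
  unfold mean moment
  congr 1
  ext β
  rw [Finset.prod_eq_single a.1]
  · simp
  · intro j _ hj
    simp [Function.update_of_ne hj]
  · simp

/-- A pattern prescribes at most one response per variable, hence the condition `hab`. -/
lemma integral_mul_eq_moment (μ : ProbabilityMeasure (BetaSpace L)) {a b : Coord L}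
    (hab : a.1 ≠ b.1) : ∫ β, β a * β b ∂(μ : Measure (BetaSpace L)) =
      moment μ (Function.update (Function.update (fun _ => none) a.1 (some a.2)) b.1
        (some b.2)) := by
  unfold moment
  congr 1
  ext β
  rw [← Finset.prod_subset (Finset.subset_univ {a.1, b.1}), Finset.prod_pair hab]
  · simp [Function.update_of_ne hab]
  · intro j _ hj
    simp only [Finset.mem_insert, Finset.mem_singleton, not_or] at hj
    simp [Function.update_of_ne hj.1, Function.update_of_ne hj.2]

lemma mean_eq_of_moment_eq (hM : ∀ ℓ : Pattern L, moment μ' ℓ = moment μ ℓ) :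
    mean μ' = mean μ := by
  ext a
  rw [mean_eq_moment, mean_eq_moment, hM]

lemma covMatrix_eq_of_moment_eq (h : IsModel L K μ Q) (h' : IsModel L K μ' Q')
    (hM : ∀ ℓ : Pattern L, moment μ' ℓ = moment μ ℓ) {a b : Coord L} (hab : a.1 ≠ b.1) :
    covMatrix μ' a b = covMatrix μ a b := by
  rw [h.covMatrix_eq, h'.covMatrix_eq, mean_eq_of_moment_eq hM, integral_mul_eq_moment _ hab,
    integral_mul_eq_moment _ hab, hM]

lemma IsModel.mean_notMem_directions (h : IsModel L K μ Q) (j : Fin J) :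
    mean μ ∉ directions L := fun hm => by
  have h1 := h.sum_mean j
  rw [hm j] at h1
  exact zero_ne_one h1

/-- The mean lies in `Q`, but its block sums are `1`, not `0`. -/
lemma IsModel.finrank_inf_directions_lt (h : IsModel L K μ Q) (j : Fin J) :
    Module.finrank ℝ (Q ⊓ directions L : Submodule ℝ (BetaSpace L)) < K := by
  rw [← h.1]
  apply Submodule.finrank_lt_finrank_of_lt
  refine lt_of_le_of_ne inf_le_left fun heq => ?_
  have := h.mean_mem
  rw [← heq] at this
  exact h.mean_notMem_directions j this.2

lemma IsModel.one_le (h : IsModel L K μ Q) (j : Fin J) : 1 ≤ L j := by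
  by_contra! h0
  have h1 := h.sum_mean j
  have : IsEmpty (Fin (L j)) := by
    rw [Nat.lt_one_iff.1 h0]
    infer_instance
  simp at h1

/-- Each covariance matrix entry is determined by the entries in different blocks. -/
lemma covMatrix_eq_of_split {m : ℕ} (h : IsModel L (m + 1) μ Q) (h' : IsModel L (m + 1) μ' Q')
    (hM : ∀ ℓ : Pattern L, moment μ' ℓ = moment μ ℓ) (hC : Generic L m (covMatrix μ))
    {S T : Finset (Fin J)} (hS : m ≤ ∑ j ∈ S, (L j - 1)) (hT : m ≤ ∑ j ∈ T, (L j - 1))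
    (hST : Disjoint S T) {a b : Coord L} (hab : a.1 = b.1) (haS : a.1 ∉ S) (haT : a.1 ∉ T) :
    covMatrix μ' a b = covMatrix μ a b := by
  obtain ⟨A, hA⟩ := exists_embedding_freeCoord L m S hS
  obtain ⟨B, hB⟩ := exists_embedding_freeCoord L m T hT
  have hoff := fun {a b : Coord L} (hab : a.1 ≠ b.1) => covMatrix_eq_of_moment_eq h h' hM hab
  have hAB : ∀ i k, covMatrix μ' (A i).toCoord (B k).toCoord
      = covMatrix μ (A i).toCoord (B k).toCoord := fun i k =>
    hoff fun e => Finset.disjoint_left.1 hST (hA i) (by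
      have := hB k
      rwa [show (A i).1 = (B k).1 from e])
  have hdet := hC A B
  have hdet' : (Matrix.of fun i k => covMatrix μ' (A i).toCoord (B k).toCoord).det ≠ 0 := by
    simpa only [hAB] using hdet
  obtain ⟨y, hy⟩ := exists_coeff_of_det_ne_zero (a := fun i => (A i).toCoord)
    (c := fun k a => covMatrix μ a (B k).toCoord)
    (Nat.lt_succ_iff.1 (h.finrank_inf_directions_lt a.1)) (fun k => h.covMatrix_mem _) hdet
    (h.covMatrix_mem b)
  obtain ⟨y', hy'⟩ := exists_coeff_of_det_ne_zero (a := fun i => (A i).toCoord)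
    (c := fun k a => covMatrix μ' a (B k).toCoord)
    (Nat.lt_succ_iff.1 (h'.finrank_inf_directions_lt a.1)) (fun k => h'.covMatrix_mem _) hdet'
    (h'.covMatrix_mem b)
  -- The rows `A` lie in `S`, while the columns `B` and `b` lie outside `S`, so both coefficient
  -- vectors solve the same invertible system of observed entries.
  have hyy : y' - y = 0 := by
    refine coeff_eq_zero_of_det_ne_zero (a := fun i => (A i).toCoord)
      (c := fun k a => covMatrix μ a (B k).toCoord) hdet fun i => ?_
    have h1 := hy (A i).toCoord
    have h2 := hy' (A i).toCoord
    simp only [hAB] at h2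
    rw [hoff (fun e => haS (by rw [hab, ← e]; exact hA i)), h1] at h2
    simp only [Pi.sub_apply, sub_mul, Finset.sum_sub_distrib]
    rw [h2, sub_self]
  -- In row `a` the expansion involves only columns from `T`, which are observed because `a.1 ∉ T`.
  rw [hy, hy', sub_eq_zero.1 hyy]
  refine Finset.sum_congr rfl fun k _ => ?_
  rw [hoff fun e => haT (by rw [e]; exact hB k)]

lemma exists_split_of_bound {m : ℕ} (hL : ∀ j, 1 ≤ L j)
    (hK : ((m + 1 : ℕ) : ℝ) ≤ (((∑ j, L j : ℕ) : ℝ) - (J : ℝ)) / 2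
      - ((Finset.univ.sup L : ℕ) : ℝ) + 5 / 2) (j₀ : Fin J) :
    ∃ S T : Finset (Fin J), m ≤ ∑ j ∈ S, (L j - 1) ∧ m ≤ ∑ j ∈ T, (L j - 1) ∧
      Disjoint S T ∧ j₀ ∉ S ∧ j₀ ∉ T := by
  have hle : ∀ j, L j ≤ Finset.univ.sup L := fun j => Finset.le_sup (Finset.mem_univ j)
  have hsum : ∑ j, (L j - 1) + J = ∑ j, L j := by
    have : ∑ j, L j = ∑ j, ((L j - 1) + 1) :=
      Finset.sum_congr rfl fun j _ => (Nat.sub_add_cancel (hL j)).symm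
    rw [this, Finset.sum_add_distrib]
    simp
  -- The hypothesis on `K` with denominators cleared. Removing `j₀` costs at most `max L - 1`,
  -- leaving exactly the requirement of `exists_split_sum_ge` with `c = max L - 1`.
  have hKn : 2 * m + 2 * Finset.univ.sup L ≤ ∑ j, (L j - 1) + 3 := by
    rw [← hsum] at hK
    push_cast at hK
    have : (2 * m + 2 * (Finset.univ.sup L : ℕ) : ℝ) ≤ ((∑ j, (L j - 1) : ℕ) : ℝ) + 3 := by
      push_cast
      linarith
    exact_mod_cast this
  have h0 := Finset.add_sum_erase Finset.univ (fun j => L j - 1) (Finset.mem_univ j₀)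
  have h1 := hle j₀
  have h2 := hL j₀
  obtain ⟨S, hSU, hS, hT⟩ := exists_split_sum_ge (Finset.univ.erase j₀) (fun j => L j - 1) m
    (Finset.univ.sup L - 1) (fun i _ => Nat.sub_le_sub_right (hle i) 1) (by omega)
  refine ⟨S, _, hS, hT, Finset.disjoint_sdiff, fun hj => ?_, fun hj => ?_⟩
  · exact Finset.notMem_erase _ _ (hSU hj)
  · exact Finset.notMem_erase _ _ (Finset.sdiff_subset hj)

/-- A supporting subspace is recovered from the covariance columns along `m` free coordinates and
the mean. -/
lemma IsModel.eq_span_sup {m : ℕ} (h : IsModel L (m + 1) μ Q) (hC : Generic L m (covMatrix μ))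
    (A : Fin m ↪ FreeCoord L) (j₀ : Fin J) :
    Submodule.span ℝ (Set.range fun k a => covMatrix μ a (A k).toCoord) ⊔
      Submodule.span ℝ {mean μ} = Q := by
  have hdet := hC A A
  have hspan := span_eq_of_det_ne_zero (a := fun i => (A i).toCoord)
    (c := fun k a => covMatrix μ a (A k).toCoord)
    (Nat.lt_succ_iff.1 (h.finrank_inf_directions_lt j₀)) (fun k => h.covMatrix_mem _) hdet
  have hfin := finrank_span_eq_card (linearIndependent_of_det_ne_zero (a := fun i => (A i).toCoord)
    (c := fun k a => covMatrix μ a (A k).toCoord) hdet)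
  rw [Fintype.card_fin] at hfin
  have hmn := h.mean_notMem_directions j₀
  apply Submodule.eq_of_le_of_finrank_le
  · rw [hspan]
    refine sup_le inf_le_left ?_
    rw [Submodule.span_singleton_le_iff_mem]
    exact h.mean_mem
  · rw [h.1, Nat.succ_le_iff]
    nth_rewrite 1 [← hfin]
    apply Submodule.finrank_lt_finrank_of_lt
    refine lt_of_le_of_ne le_sup_left fun heq => hmn ?_
    have hmem : mean μ ∈ Submodule.span ℝ (Set.range fun k a => covMatrix μ a (A k).toCoord) := by
      rw [heq]
      exact Submodule.mem_sup_right (Submodule.mem_span_singleton_self _)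
    rw [hspan] at hmem
    exact hmem.2

lemma IsModel.supporting_subspace_unique {m : ℕ} (h : IsModel L (m + 1) μ Q)
    (h' : IsModel L (m + 1) μ' Q') (hM : ∀ ℓ : Pattern L, moment μ' ℓ = moment μ ℓ)
    (hC : Generic L m (covMatrix μ))
    (hK : ((m + 1 : ℕ) : ℝ) ≤ (((∑ j, L j : ℕ) : ℝ) - (J : ℝ)) / 2
      - ((Finset.univ.sup L : ℕ) : ℝ) + 5 / 2) (j₀ : Fin J) : Q' = Q := by
  have hcov : covMatrix μ' = covMatrix μ := by
    ext a b
    by_cases hab : a.1 = b.1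
    · obtain ⟨S, T, hS, hT, hST, haS, haT⟩ := exists_split_of_bound h.one_le hK a.1
      exact covMatrix_eq_of_split h h' hM hC hS hT hST hab haS haT
    · exact covMatrix_eq_of_moment_eq h h' hM hab
  obtain ⟨S, -, hS, -⟩ := exists_split_of_bound h.one_le hK j₀
  obtain ⟨A, -⟩ := exists_embedding_freeCoord L m S hS
  rw [← h.eq_span_sup hC A j₀, ← h'.eq_span_sup (hcov ▸ hC) A j₀, hcov, mean_eq_of_moment_eq hM]

/-- Sufficiently many coordinates, together with a block sum, determine a point of `Q`. -/
lemma IsModel.eq_zero_of_block_eq_zero {m : ℕ} (h : IsModel L (m + 1) μ Q)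
    (hC : Generic L m (covMatrix μ)) (j₀ : Fin J) {Z : Finset (Fin J)}
    (hZ : m ≤ ∑ j ∈ Z, (L j - 1)) {x : BetaSpace L} (hx : x ∈ Q)
    (hxZ : ∀ j ∈ Z, ∀ l, x ⟨j, l⟩ = 0) (hx0 : ∑ l, x ⟨j₀, l⟩ = 0) : x = 0 := by
  obtain ⟨A, hA⟩ := exists_embedding_freeCoord L m Z hZ
  have hdet := hC A A
  have hspan := span_eq_of_det_ne_zero (a := fun i => (A i).toCoord)
    (c := fun k a => covMatrix μ a (A k).toCoord)
    (Nat.lt_succ_iff.1 (h.finrank_inf_directions_lt j₀)) (fun k => h.covMatrix_mem _) hdet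
  have hxQ := hx
  rw [← h.eq_span_sup hC A j₀, hspan, Submodule.mem_sup] at hxQ
  obtain ⟨w, hw, z, hz, rfl⟩ := hxQ
  obtain ⟨t, rfl⟩ := Submodule.mem_span_singleton.1 hz
  -- Directions have zero block sums and the mean has block sum `1`, so `hx0` isolates the
  -- coefficient of the mean.
  have ht : t = 0 := by
    have hw0 := hw.2 j₀
    simpa [Finset.sum_add_distrib, hw0, ← Finset.mul_sum, h.sum_mean j₀] using hx0
  rw [ht, zero_smul, add_zero] at hxZ ⊢
  exact eq_zero_of_det_ne_zero (a := fun i => (A i).toCoord)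
    (c := fun k a => covMatrix μ a (A k).toCoord)
    (Nat.lt_succ_iff.1 (h.finrank_inf_directions_lt j₀)) (fun k => h.covMatrix_mem _) hdet hw
    fun i => hxZ _ (hA i) _

end Model

/-! ### The linear recursion for mixed moments. -/

section CondMoment

variable {J : ℕ} {L : Fin J → ℕ} {K : ℕ} {μ μ' : ProbabilityMeasure (BetaSpace L)}
  {Q : Submodule ℝ (BetaSpace L)} {lam : Fin K → BetaSpace L}

lemma point_apply (lam : Fin K → BetaSpace L) (g : Fin K → ℝ) (a : Coord L) :
    point lam g a = ∑ k, g k * lam k a := by simp [point]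

lemma point_eq_linearCombination (lam : Fin K → BetaSpace L) :
    point lam = Fintype.linearCombination ℝ lam := by
  ext g : 1
  simp [point, Fintype.linearCombination_apply]

lemma continuous_point (lam : Fin K → BetaSpace L) : Continuous (point lam) := by
  unfold point
  fun_prop

lemma IsBasisOf.ker_eq_bot (hb : IsBasisOf lam Q) :
    (Fintype.linearCombination ℝ lam).ker = ⊥ :=
  LinearMap.ker_eq_bot.2 hb.1.fintypeLinearCombination_injective

lemma IsBasisOf.isClosedEmbedding (hb : IsBasisOf lam Q) :
    Topology.IsClosedEmbedding (point lam) := by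
  rw [point_eq_linearCombination]
  exact LinearMap.isClosedEmbedding_of_injective hb.ker_eq_bot

lemma IsBasisOf.range_point (hb : IsBasisOf lam Q) : Set.range (point lam) = Q := by
  rw [point_eq_linearCombination, ← LinearMap.coe_range, Fintype.range_linearCombination, hb.2]

lemma map_point_coordMeasure (h : IsModel L K μ Q) (hb : IsBasisOf lam Q) :
    (coordMeasure μ lam).map (point lam) = μ := by
  unfold coordMeasure
  rw [hb.isClosedEmbedding.measurableEmbedding.map_comap, hb.range_point]
  exact Measure.restrict_eq_self_of_ae_mem (h.2.mono fun _ hβ => hβ.2)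

lemma isProbabilityMeasure_coordMeasure (h : IsModel L K μ Q) (hb : IsBasisOf lam Q) :
    IsProbabilityMeasure (coordMeasure μ lam) := by
  constructor
  have h1 : (coordMeasure μ lam).map (point lam) Set.univ = 1 := by
    rw [map_point_coordMeasure h hb]
    exact measure_univ
  rwa [Measure.map_apply (continuous_point lam).measurable MeasurableSet.univ,
    Set.preimage_univ] at h1

lemma ae_coordMeasure_point_mem (h : IsModel L K μ Q) (hb : IsBasisOf lam Q) :
    ∀ᵐ g ∂(coordMeasure μ lam), point lam g ∈ polyhedron L := by
  refine ae_of_ae_map (continuous_point lam).aemeasurable ?_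
  rw [map_point_coordMeasure h hb]
  exact h.2.mono fun _ hβ => hβ.1

lemma integrable_coordMeasure (h : IsModel L K μ Q) (hb : IsBasisOf lam Q)
    {f : (Fin K → ℝ) → ℝ} (hf : Continuous f) : Integrable f (coordMeasure μ lam) := by
  have := isProbabilityMeasure_coordMeasure h hb
  exact integrable_of_ae_mem_compact
    (hb.isClosedEmbedding.isCompact_preimage (isCompact_polyhedron L))
    (ae_coordMeasure_point_mem h hb) hf

/-- The product of the probabilities, at the point `β`, of the responses prescribed by `ℓ`. -/
noncomputable def patternProb (ℓ : Pattern L) (β : BetaSpace L) : ℝ :=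
  ∏ j, (ℓ j).elim 1 (fun l => β ⟨j, l⟩)

lemma continuous_patternProb (ℓ : Pattern L) : Continuous (patternProb ℓ) := by
  refine continuous_finsetProd _ fun j _ => ?_
  cases ℓ j with
  | none => exact continuous_const
  | some l => exact continuous_apply _

lemma patternProb_update (ℓ : Pattern L) {j : Fin J} (hj : ℓ j = none) (l : Fin (L j))
    (β : BetaSpace L) :
    patternProb (Function.update ℓ j (some l)) β = β ⟨j, l⟩ * patternProb ℓ β := by
  unfold patternProb
  rw [← Finset.mul_prod_erase _ _ (Finset.mem_univ j),
    ← Finset.mul_prod_erase Finset.univ (fun i => (ℓ i).elim 1 (fun l => β ⟨i, l⟩))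
      (Finset.mem_univ j), hj]
  simp only [Function.update_self, Option.elim_some, Option.elim_none, one_mul]
  congr 1
  refine Finset.prod_congr rfl fun i hi => ?_
  rw [Function.update_of_ne (Finset.ne_of_mem_erase hi)]

/-- The mixed moment `E(G^v; X = ℓ)`. -/
noncomputable def mixedMoment (μ : ProbabilityMeasure (BetaSpace L)) (lam : Fin K → BetaSpace L)
    (ℓ : Pattern L) (v : Fin K → ℕ) : ℝ :=
  ∫ g, (∏ k, g k ^ v k) * patternProb ℓ (point lam g) ∂(coordMeasure μ lam)

lemma continuous_mixed (lam : Fin K → BetaSpace L) (ℓ : Pattern L) (v : Fin K → ℕ) :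
    Continuous fun g : Fin K → ℝ => (∏ k, g k ^ v k) * patternProb ℓ (point lam g) := by
  have := (continuous_patternProb ℓ).comp (continuous_point lam)
  exact Continuous.mul (by fun_prop) this

lemma mixedMoment_zero (h : IsModel L K μ Q) (hb : IsBasisOf lam Q) (ℓ : Pattern L) :
    mixedMoment μ lam ℓ 0 = moment μ ℓ := by
  unfold mixedMoment moment
  simp only [Pi.zero_apply, pow_zero, Finset.prod_const_one, one_mul]
  rw [← hb.isClosedEmbedding.measurableEmbedding.integral_map (g := patternProb ℓ),
    map_point_coordMeasure h hb]
  rfl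

lemma sum_mul_mixedMoment (h : IsModel L K μ Q) (hb : IsBasisOf lam Q) (ℓ : Pattern L)
    (w : Fin K → ℕ) (s : Fin K → ℝ) :
    ∑ k, mixedMoment μ lam ℓ (w + Pi.single k 1) * s k =
      ∫ g, (∑ k, g k * s k) * ((∏ k, g k ^ w k) * patternProb ℓ (point lam g))
        ∂(coordMeasure μ lam) := by
  unfold mixedMoment
  simp only [← integral_mul_const]
  rw [← integral_finsetSum _ fun k _ => (integrable_coordMeasure h hb
    (continuous_mixed lam ℓ _)).mul_const _]
  congr 1
  ext g
  rw [Finset.sum_mul]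
  refine Finset.sum_congr rfl fun k _ => ?_
  have : ∏ i, g i ^ (w + Pi.single k 1 : Fin K → ℕ) i = g k * ∏ i, g i ^ w i := by
    simp only [Pi.add_apply, pow_add, Finset.prod_mul_distrib]
    rw [mul_comm, Finset.prod_eq_single k (f := fun i => g i ^ (Pi.single k 1 : Fin K → ℕ) i)]
    · simp
    · intro i _ hi
      simp [Pi.single_eq_of_ne hi]
    · simp
  rw [this]
  ring

/-- The contraction inserts the factor `β_{jl}` into the integrand, which amounts to prescribing
response `l` at the free place `j`. -/
lemma sum_mixedMoment_mul_coord (h : IsModel L K μ Q) (hb : IsBasisOf lam Q) (ℓ : Pattern L)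
    (w : Fin K → ℕ) {j : Fin J} (hj : ℓ j = none) (l : Fin (L j)) :
    ∑ k, mixedMoment μ lam ℓ (w + Pi.single k 1) * lam k ⟨j, l⟩ =
      mixedMoment μ lam (Function.update ℓ j (some l)) w := by
  rw [sum_mul_mixedMoment h hb]
  unfold mixedMoment
  congr 1
  ext g
  rw [patternProb_update ℓ hj, point_apply]
  ring

/-- The inserted factor is now a block sum, almost surely `1`. This supplies the one equation beyond
the `m` free coordinates. -/
lemma sum_mixedMoment_mul_blockSum (h : IsModel L K μ Q) (hb : IsBasisOf lam Q) (ℓ : Pattern L)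
    (w : Fin K → ℕ) (j : Fin J) :
    ∑ k, mixedMoment μ lam ℓ (w + Pi.single k 1) * ∑ l, lam k ⟨j, l⟩ =
      mixedMoment μ lam ℓ w := by
  rw [sum_mul_mixedMoment h hb]
  unfold mixedMoment
  refine integral_congr_ae ((ae_coordMeasure_point_mem h hb).mono fun g hg => ?_)
  have h1 := hg.1 j
  simp only [point_apply] at h1
  rw [Finset.sum_comm] at h1
  simp only [← Finset.mul_sum] at h1
  simp only [h1, one_mul]

lemma mem_zeros {ℓ : Pattern L} {j : Fin J} : j ∈ ℓ.zeros ↔ ℓ j = none := by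
  simp [Pattern.zeros]

lemma EnoughZeros.mono {ℓ : Pattern L} {d e : ℕ} (h : EnoughZeros K ℓ e) (hde : d ≤ e) :
    EnoughZeros K ℓ d :=
  fun T hT hTd => h T hT (hTd.trans_le hde)

/-- The newly filled place is counted among the discarded zeros, which uses up one unit of the
order. -/
lemma EnoughZeros.update {ℓ : Pattern L} {d : ℕ} (h : EnoughZeros K ℓ (d + 1)) {j : Fin J}
    (hj : ℓ j = none) (l : Fin (L j)) :
    EnoughZeros K (Function.update ℓ j (some l) : Pattern L) d := by
  have hz : Pattern.zeros (Function.update ℓ j (some l) : Pattern L) = ℓ.zeros.erase j := by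
    ext i
    rw [mem_zeros, Finset.mem_erase, mem_zeros]
    by_cases hi : i = j
    · subst hi
      simp
    · simp [hi]
  intro T hT hTd
  rw [hz] at hT ⊢
  have := h (insert j T) (Finset.insert_subset (mem_zeros.2 hj) (hT.trans (Finset.erase_subset _ _)))
    ((Finset.card_insert_le _ _).trans_lt (by omega))
  rwa [Finset.erase_sdiff_comm, ← Finset.sdiff_insert] at *

lemma mixedMoment_unique {m : ℕ} {lam : Fin (m + 1) → BetaSpace L} (h : IsModel L (m + 1) μ Q)
    (h' : IsModel L (m + 1) μ' Q) (hM : ∀ ℓ : Pattern L, moment μ' ℓ = moment μ ℓ)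
    (hC : Generic L m (covMatrix μ)) (j₀ : Fin J) (hb : IsBasisOf lam Q) (d : ℕ) :
    ∀ (ℓ : Pattern L) (v : Fin (m + 1) → ℕ), ∑ k, v k = d → EnoughZeros (m + 1) ℓ d →
      mixedMoment μ' lam ℓ v = mixedMoment μ lam ℓ v := by
  induction d with
  | zero =>
    intro ℓ v hv _
    have : v = 0 := by
      ext k
      exact Finset.sum_eq_zero_iff.1 hv k (Finset.mem_univ k)
    rw [this, mixedMoment_zero h hb, mixedMoment_zero h' hb, hM]
  | succ d ih =>
    intro ℓ v hv hE
    obtain ⟨k₀, hk₀⟩ : ∃ k, v k ≠ 0 := by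
      by_contra! hall
      simp [hall] at hv
    obtain ⟨w, rfl⟩ : ∃ w, v = w + Pi.single k₀ 1 := by
      refine ⟨v - Pi.single k₀ 1, (tsub_add_cancel_of_le fun k => ?_).symm⟩
      by_cases hk : k = k₀
      · subst hk
        simpa using Nat.one_le_iff_ne_zero.2 hk₀
      · simp [hk]
    have hw : ∑ k, w k = d := by
      simp only [Pi.add_apply, Finset.sum_add_distrib, Finset.sum_pi_single', Finset.mem_univ,
        if_true] at hv
      omega
    -- All the moments `w + e_k` are compared at once: the recursion determines this whole vector,
    -- not its entries separately.
    let x : Fin (m + 1) → ℝ := fun k =>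
      mixedMoment μ' lam ℓ (w + Pi.single k 1) - mixedMoment μ lam ℓ (w + Pi.single k 1)
    have hZ : m ≤ ∑ j ∈ ℓ.zeros, (L j - 1) := by
      have := hE ∅ (Finset.empty_subset _) (by simp)
      simpa using this
    have hpx : point lam x = 0 := by
      refine h.eq_zero_of_block_eq_zero hC j₀ hZ ?_ ?_ ?_
      · have : point lam x ∈ Set.range (point lam) := ⟨x, rfl⟩
        rwa [hb.range_point] at this
      · intro j hj l
        rw [mem_zeros] at hj
        rw [point_apply]
        simp only [x, sub_mul, Finset.sum_sub_distrib]
        rw [sum_mixedMoment_mul_coord h hb ℓ w hj, sum_mixedMoment_mul_coord h' hb ℓ w hj,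
          ih _ w hw (hE.update hj l), sub_self]
      · simp only [point_apply]
        rw [Finset.sum_comm]
        simp only [← Finset.mul_sum]
        simp only [x, sub_mul, Finset.sum_sub_distrib]
        rw [sum_mixedMoment_mul_blockSum h hb, sum_mixedMoment_mul_blockSum h' hb,
          ih _ w hw (hE.mono (Nat.le_succ d)), sub_self]
    have hx : x = 0 := by
      apply hb.isClosedEmbedding.injective
      rw [hpx]
      simp [point]
    exact sub_eq_zero.1 (congrFun hx k₀)

/-! ### From mixed moments to conditional moments. -/

/-- The responses compatible with a pattern at one place. -/
def allowed (ℓ : Pattern L) (j : Fin J) : Finset (Fin (L j)) :=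
  (ℓ j).elim Finset.univ fun l => {l}

lemma mem_matchEvent_iff (ℓ : Pattern L) (z : ((j : Fin J) → Fin (L j)) × (Fin K → ℝ)) :
    z ∈ matchEvent K ℓ ↔ z.1 ∈ Fintype.piFinset (allowed ℓ) := by
  simp only [matchEvent, Set.mem_ofPred_eq, Fintype.mem_piFinset, allowed]
  refine forall_congr' fun j => ?_
  cases ℓ j with
  | none => simp
  | some l => simp

/-- The sum factors over places, and each unprescribed place contributes a block sum equal to `1`.
-/
lemma sum_prod_allowed (ℓ : Pattern L) {β : BetaSpace L} (hβ : β ∈ polyhedron L) :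
    ∑ x ∈ Fintype.piFinset (allowed ℓ), ∏ j, β ⟨j, x j⟩ = patternProb ℓ β := by
  rw [← Finset.prod_univ_sum (allowed ℓ) fun j l => β ⟨j, l⟩]
  refine Finset.prod_congr rfl fun j _ => ?_
  unfold allowed
  cases ℓ j with
  | none => simpa using hβ.1 j
  | some l => simp

lemma measurableSet_matchEvent (ℓ : Pattern L) : MeasurableSet (matchEvent K ℓ) := by
  have : matchEvent K ℓ = Prod.fst ⁻¹' (Fintype.piFinset (allowed ℓ) : Set _) := by
    ext z
    simpa using mem_matchEvent_iff ℓ z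
  rw [this]
  exact measurable_fst (Finset.measurableSet _)

lemma setIntegral_jointLaw (h : IsModel L K μ Q) (hb : IsBasisOf lam Q) (ℓ : Pattern L)
    (v : Fin K → ℕ) :
    ∫ z in matchEvent K ℓ, ∏ k, z.2 k ^ v k ∂(jointLaw μ lam) = mixedMoment μ lam ℓ v := by
  classical
  have := isProbabilityMeasure_coordMeasure h hb
  have hE := measurableSet_matchEvent (K := K) ℓ
  have hcont : ∀ x : (j : Fin J) → Fin (L j),
      Continuous fun g : Fin K → ℝ => ∏ j, point lam g ⟨j, x j⟩ := fun x =>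
    continuous_finsetProd _ fun j _ => (continuous_apply _).comp (continuous_point lam)
  -- Nonnegativity on the polyhedron ensures that `ENNReal.ofReal` truncates nothing in the density.
  have hpos : ∀ x : (j : Fin J) → Fin (L j), ∀ᵐ g ∂(coordMeasure μ lam),
      (ENNReal.ofReal (∏ j, point lam g ⟨j, x j⟩)).toReal = ∏ j, point lam g ⟨j, x j⟩ := fun x =>
    (ae_coordMeasure_point_mem h hb).mono fun g hg =>
      ENNReal.toReal_ofReal (Finset.prod_nonneg fun j _ => hg.2 j _)
  have hmeas : ∀ x : (j : Fin J) → Fin (L j), Measurable fun g : Fin K → ℝ =>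
      ENNReal.ofReal (∏ j, point lam g ⟨j, x j⟩) := fun x => (hcont x).measurable.ennreal_ofReal
  have hvc : Continuous fun g : Fin K → ℝ => ∏ k, g k ^ v k := by fun_prop
  let f : ((j : Fin J) → Fin (L j)) × (Fin K → ℝ) → ℝ :=
    (matchEvent K ℓ).indicator fun z => ∏ k, z.2 k ^ v k
  have hf : Measurable f := by
    refine Measurable.indicator ?_ hE
    exact hvc.measurable.comp measurable_snd
  have hfx : ∀ x g, f (x, g) =
      if x ∈ Fintype.piFinset (allowed ℓ) then ∏ k, g k ^ v k else 0 := by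
    intro x g
    simp only [f, Set.indicator_apply, mem_matchEvent_iff]
  let ρ : ((j : Fin J) → Fin (L j)) → Measure (Fin K → ℝ) := fun x =>
    (coordMeasure μ lam).withDensity fun g => ENNReal.ofReal (∏ j, point lam g ⟨j, x j⟩)
  have hint0 : ∀ x, Integrable (fun g => f (x, g)) (ρ x) := by
    intro x
    rw [integrable_withDensity_iff_integrable_smul' (hmeas x)
      (Filter.Eventually.of_forall fun _ => ENNReal.ofReal_lt_top)]
    have hi : Integrable (fun g => (∏ j, point lam g ⟨j, x j⟩) • f (x, g))
        (coordMeasure μ lam) := by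
      refine integrable_coordMeasure h hb ((hcont x).smul ?_)
      simp only [hfx]
      split_ifs
      · exact hvc
      · exact continuous_const
    refine hi.congr ((hpos x).mono fun g hg => ?_)
    simp only [hg]
  have hint : ∀ x ∈ Finset.univ, Integrable f ((Measure.dirac x).prod (ρ x)) := by
    intro x _
    rw [Measure.dirac_prod, integrable_map_measure hf.aestronglyMeasurable (by fun_prop)]
    exact hint0 x
  rw [← integral_indicator hE]
  change ∫ z, f z ∂(∑ x, (Measure.dirac x).prod (ρ x)) = _
  rw [integral_finsetSum_measure hint]
  have hterm : ∀ x, ∫ z, f z ∂((Measure.dirac x).prod (ρ x)) =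
      ∫ g, (if x ∈ Fintype.piFinset (allowed ℓ) then
        (∏ k, g k ^ v k) * ∏ j, point lam g ⟨j, x j⟩ else 0) ∂(coordMeasure μ lam) := by
    intro x
    rw [Measure.dirac_prod, integral_map (by fun_prop) hf.aestronglyMeasurable,
      integral_withDensity_eq_integral_toReal_smul (hmeas x)
        (Filter.Eventually.of_forall fun _ => ENNReal.ofReal_lt_top)]
    refine integral_congr_ae ((hpos x).mono fun g hg => ?_)
    simp only [hg, hfx, smul_eq_mul]
    split_ifs
    · ring
    · simp
  simp only [hterm]
  rw [← integral_finsetSum]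
  · refine integral_congr_ae ((ae_coordMeasure_point_mem h hb).mono fun g hg => ?_)
    simp only [Finset.sum_ite_mem, Finset.univ_inter, ← Finset.mul_sum, sum_prod_allowed ℓ hg]
  · intro x _
    refine integrable_coordMeasure h hb ?_
    split_ifs
    · exact hvc.mul (hcont x)
    · exact continuous_const

/-- This holds even when the moment of `ℓ` vanishes: the scaling factor is then `∞`, whose `toReal`
is `0`, in agreement with `0⁻¹ = 0`. -/
lemma condMoment_eq (h : IsModel L K μ Q) (hb : IsBasisOf lam Q) (ℓ : Pattern L)
    (v : Fin K → ℕ) : condMoment μ lam ℓ v = (moment μ ℓ)⁻¹ * mixedMoment μ lam ℓ v := by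
  have h1 : (jointLaw μ lam).real (matchEvent K ℓ) = moment μ ℓ := by
    rw [← mixedMoment_zero h hb ℓ, ← setIntegral_jointLaw h hb]
    simp
  unfold condMoment ProbabilityTheory.cond
  rw [integral_smul_measure, setIntegral_jointLaw h hb, ENNReal.toReal_inv, ← h1]
  rfl

end CondMoment

lemma probabilityMeasure_eq_of_subsingleton {X : Type*} [MeasurableSpace X] [Subsingleton X]
    (μ μ' : ProbabilityMeasure X) : μ' = μ := by
  refine Subtype.ext (?_ : (μ' : Measure X) = μ)
  ext s _
  rcases s.eq_empty_or_nonempty with rfl | hs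
  · simp
  · rw [Subsingleton.eq_univ_of_nonempty hs, measure_univ, measure_univ]

end LLS

theorem mainTheorem1 {J : ℕ} (L : Fin J → ℕ) (K : ℕ)
    (hK : (K : ℝ) ≤ (((∑ j, L j : ℕ) : ℝ) - (J : ℝ)) / 2
      - ((Finset.univ.sup L : ℕ) : ℝ) + 5 / 2)
    (ν : MeasureTheory.Measure (LLS.MixingDistribution L K))
    (hν : (ν.map fun μ => LLS.covMatrix μ.1).AbsolutelyContinuous (LLS.covLebesgue L (K - 1))) :
    ∀ᵐ μ ∂ν, ∀ Q : Submodule ℝ (LLS.BetaSpace L),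
      LLS.IsModel L K μ.1 Q → LLS.Identifiable L K μ.1 Q := by
  filter_upwards [LLS.ae_generic_covMatrix hν] with μ hC Q h μ' Q' h' hM
  rcases Nat.eq_zero_or_pos J with rfl | hJ
  -- Without variables the ambient space is a single point, and any two mixing distributions
  -- coincide.
  · have hμ := LLS.probabilityMeasure_eq_of_subsingleton μ.1 μ'
    refine ⟨Subsingleton.elim _ _, fun lam _ ℓ v _ _ => ?_⟩
    rw [hμ]
  · have j₀ : Fin J := ⟨0, hJ⟩
    obtain ⟨m, rfl⟩ : ∃ m, K = m + 1 :=
      Nat.exists_eq_add_of_lt (Nat.zero_lt_of_lt (h.finrank_inf_directions_lt j₀)) |>.imp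
        fun m hm => by omega
    rw [Nat.add_sub_cancel] at hC
    obtain rfl := h.supporting_subspace_unique h' hM hC hK j₀
    refine ⟨rfl, fun lam hb ℓ v hE _ => ?_⟩
    rw [LLS.condMoment_eq h hb, LLS.condMoment_eq h' hb, hM,
      LLS.mixedMoment_unique h h' hM hC j₀ hb _ ℓ v rfl hE]
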